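/- Let $K\subset\mathbb R^4$ be a star body, i.e. a compact set with the origin in its interior such that every line through the origin meets the boundary of $K$ in exactly two points different from the origin, and let $\|x\|_K=\min\{a\ge 0: x\in aK\}$ be its Minkowski functional. Suppose that $K$ is contained in the open Euclidean unit ball $\{x\in\mathbb R^4:|x|<1\}$ and that $K$ is $R_\theta$-invariant, i.e. for every $\theta\in[0,2\pi]$ and every $\xi=(\xi_{11},\xi_{12},\xi_{21},\xi_{22})\in\mathbb R^4$, $$\|\xi\|_K=\|(R_\theta(\xi_{11},\xi_{12}),R_\theta(\xi_{21},\xi_{22}))\|_K,$$ where $R_\theta$ is the counterclockwise rotation of $\mathbb R^2$ by the angle $\theta$ about the origin. Then the function $$f(x)=\frac{\|x\|_K^{-2}}{1-\left(\frac{|x|}{\|x\|_K}\right)^2}$$ defines, by $\langle f,\varphi\rangle=\int_{\mathbb R^4}f(x)\varphi(x)\,dx$ (the integrals converging absolutely), a tempered distribution on $\mathbb R^4$, and this distribution is positive definite: for every complex-valued Schwartz function $\varphi$ on $\mathbb R^4$, $$\left\langle f,\ \varphi*\overline{\varphi(-\,\cdot\,)}\right\rangle\ \ge\ 0 .$$ 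-/

import Mathlib

open MeasureTheory
open scoped SchwartzMap ComplexOrder ComplexConjugate Convolution

noncomputable section

/-- The space `ℝ⁴ ≅ ℂ²`, with coordinates `(ξ₁₁, ξ₁₂, ξ₂₁, ξ₂₂)` standing for
`(ξ₁₁ + i ξ₁₂, ξ₂₁ + i ξ₂₂)`, and with the Euclidean norm. -/
abbrev R4 : Type := EuclideanSpace ℝ (Fin 4)

/-- A star body: a compact set having the origin in its interior, such that every line through
the origin meets the boundary in exactly two points different from the origin. -/
structure IsStarBody {E : Type*} [NormedAddCommGroup E] [NormedSpace ℝ E] (K : Set E) : Prop where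
  isCompact : IsCompact K
  zero_mem_interior : (0 : E) ∈ interior K
  ncard_line_inter_frontier : ∀ v : E, v ≠ 0 →
    {y : E | y ∈ frontier K ∧ y ∈ Submodule.span ℝ {v} ∧ y ≠ 0}.ncard = 2

/-- Simultaneous counterclockwise rotation by the angle `θ` in the two coordinate planes
of `ℝ⁴ = ℝ² × ℝ²`. -/
def rotTheta (θ : ℝ) (x : R4) : R4 :=
  !₂[Real.cos θ * x 0 - Real.sin θ * x 1, Real.sin θ * x 0 + Real.cos θ * x 1,
     Real.cos θ * x 2 - Real.sin θ * x 3, Real.sin θ * x 2 + Real.cos θ * x 3]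

/-- `R_θ`-invariance of a body in `ℝ⁴`, in terms of its Minkowski functional `gauge K`. -/
def IsRThetaInvariant (K : Set R4) : Prop :=
  ∀ θ ∈ Set.Icc (0 : ℝ) (2 * Real.pi), ∀ x : R4, gauge K (rotTheta θ x) = gauge K x

/-- The function `x ↦ ‖x‖_K⁻² / (1 - (|x| / ‖x‖_K)²)`. -/
def hyperbolicDensity (K : Set R4) (x : R4) : ℝ :=
  (gauge K x) ^ (-2 : ℤ) / (1 - (‖x‖ / gauge K x) ^ 2)

section PositiveDefinite

variable {E : Type*} [NormedAddCommGroup E] [InnerProductSpace ℝ E]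

/-- The test function `x ↦ conj (φ (-x))`. -/
def conjReflection (φ : 𝓢(E, ℂ)) : 𝓢(E, ℂ) :=
  SchwartzMap.postcompCLM (Complex.conjCLE : ℂ →L[ℝ] ℂ)
    (SchwartzMap.compCLMOfContinuousLinearEquiv ℝ (ContinuousLinearEquiv.neg ℝ) φ)

theorem conjReflection_apply (φ : 𝓢(E, ℂ)) (x : E) :
    conjReflection φ x = conj (φ (-x)) := rfl

variable [FiniteDimensional ℝ E] [MeasurableSpace E] [BorelSpace E]

/-- The test function `φ ∗ conj (φ (-·))`. -/
def autoConvolution (φ : 𝓢(E, ℂ)) : 𝓢(E, ℂ) :=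
  SchwartzMap.convolution (ContinuousLinearMap.mul ℂ ℂ) φ (conjReflection φ)

theorem autoConvolution_apply (φ : 𝓢(E, ℂ)) (x : E) :
    autoConvolution φ x = ∫ y, φ y * conj (φ (y - x)) := by
  simp [autoConvolution, SchwartzMap.convolution_apply, convolution, conjReflection_apply]

/-- A tempered distribution `T` is positive definite if `⟨T, φ ∗ conj (φ (-·))⟩ ≥ 0` for every
test function `φ`; here `0 ≤ z` for `z : ℂ` says that `z` is real and nonnegative. -/
def IsPositiveDefiniteDistribution (T : 𝓢'(E, ℂ)) : Prop :=
  ∀ φ : 𝓢(E, ℂ), 0 ≤ T (autoConvolution φ)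

/-- The tempered distribution `T` is given by integration against the function `f`. -/
def IsRepresentedBy (T : 𝓢'(E, ℂ)) (f : E → ℝ) : Prop :=
  ∀ φ : 𝓢(E, ℂ), Integrable (fun x => (f x : ℂ) * φ x) ∧ T φ = ∫ x, (f x : ℂ) * φ x

end PositiveDefinite

end

noncomputable section

/-! ### Multiplication by complex scalars on `ℝ⁴ ≅ ℂ²` -/

/-- Multiplication by the complex number `z` on `ℝ⁴ ≅ ℂ²`. -/
def complexScale (z : ℂ) (x : R4) : R4 :=
  !₂[z.re * x 0 - z.im * x 1, z.im * x 0 + z.re * x 1,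
     z.re * x 2 - z.im * x 3, z.im * x 2 + z.re * x 3]

theorem norm_sq_R4 (x : R4) : ‖x‖ ^ 2 = x 0 ^ 2 + x 1 ^ 2 + x 2 ^ 2 + x 3 ^ 2 := by
  simp [EuclideanSpace.norm_sq_eq, Fin.sum_univ_four]

theorem norm_complexScale (z : ℂ) (x : R4) : ‖complexScale z x‖ = ‖z‖ * ‖x‖ := by
  rw [← sq_eq_sq₀ (norm_nonneg _) (by positivity), mul_pow, norm_sq_R4, norm_sq_R4, Complex.sq_norm,
    Complex.normSq_apply]
  simp only [complexScale, PiLp.toLp_apply, Matrix.cons_val]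
  ring

theorem continuous_complexScale : Continuous fun p : ℂ × R4 => complexScale p.1 p.2 := by
  unfold complexScale
  refine (PiLp.continuous_toLp 2 _).comp (continuous_pi fun i => ?_)
  fin_cases i <;> simp <;> fun_prop

/-- The rotation `rotTheta θ` as a linear isometry. -/
def rotThetaIsometry (θ : ℝ) : R4 →ₗᵢ[ℝ] R4 where
  toFun := rotTheta θ
  map_add' x y := by
    ext i; fin_cases i <;> simp [rotTheta] <;> ring
  map_smul' c x := by
    ext i; fin_cases i <;> simp [rotTheta] <;> ring
  norm_map' x := by
    change ‖rotTheta θ x‖ = ‖x‖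
    rw [← sq_eq_sq₀ (norm_nonneg _) (norm_nonneg _), norm_sq_R4, norm_sq_R4]
    simp only [rotTheta, PiLp.toLp_apply, Matrix.cons_val]
    linear_combination (x 0 ^ 2 + x 1 ^ 2 + x 2 ^ 2 + x 3 ^ 2) * Real.sin_sq_add_cos_sq θ

theorem complexScale_eq_rotTheta (z : ℂ) (x : R4) :
    complexScale z x = rotTheta z.arg (‖z‖ • x) := by
  have h1 : ‖z‖ * Real.cos z.arg = z.re := Complex.norm_mul_cos_arg z
  have h2 : ‖z‖ * Real.sin z.arg = z.im := Complex.norm_mul_sin_arg z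
  unfold rotTheta complexScale
  generalize Real.cos z.arg = c at *
  generalize Real.sin z.arg = s at *
  rw [← h1, ← h2]
  ext i
  fin_cases i <;> simp <;> ring

theorem measurePreserving_rotTheta (θ : ℝ) : MeasurePreserving (rotTheta θ) :=
  ((rotThetaIsometry θ).toLinearIsometryEquiv rfl).measurePreserving

theorem integral_comp_complexScale (h : R4 → ℂ) (z : ℂ) :
    ∫ x, h (complexScale z x) = ((‖z‖ ^ 4)⁻¹ : ℝ) • ∫ x, h x := by
  simp_rw [complexScale_eq_rotTheta]
  rw [Measure.integral_comp_smul volume (fun x => h (rotTheta z.arg x)),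
    (measurePreserving_rotTheta z.arg).integral_comp
      ((rotThetaIsometry z.arg).toLinearIsometryEquiv rfl).toHomeomorph.measurableEmbedding]
  simp

/-- The vector `(-ξ̄₂, ξ̄₁)`, spanning the complex orthogonal complement of `(ξ₁, ξ₂)`. -/
def complexPerp (x : R4) : R4 := !₂[-x 2, x 3, x 0, -x 1]

/-- The map `(a, b) ↦ a x + b x'`, with `x'` spanning the complex orthogonal complement of `x`. -/
def complexFrame (x : R4) : ℂ × ℂ →ₗ[ℝ] R4 where
  toFun p := complexScale p.1 x + complexScale p.2 (complexPerp x)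
  map_add' p q := by
    ext i; fin_cases i <;> simp [complexScale, complexPerp] <;> ring
  map_smul' c p := by
    ext i; fin_cases i <;> simp [complexScale, complexPerp] <;> ring

theorem complexFrame_apply (x : R4) (p : ℂ × ℂ) :
    complexFrame x p = complexScale p.1 x + complexScale p.2 (complexPerp x) := rfl

theorem norm_sq_complexFrame (x : R4) (p : ℂ × ℂ) :
    ‖complexFrame x p‖ ^ 2 = (‖p.1‖ ^ 2 + ‖p.2‖ ^ 2) * ‖x‖ ^ 2 := by
  rw [norm_sq_R4, norm_sq_R4, Complex.sq_norm, Complex.sq_norm, Complex.normSq_apply,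
    Complex.normSq_apply]
  simp only [complexFrame_apply, complexScale, complexPerp, PiLp.add_apply, PiLp.toLp_apply,
    Matrix.cons_val]
  ring

theorem complexFrame_injective {x : R4} (hx : x ≠ 0) : Function.Injective (complexFrame x) := by
  rw [injective_iff_map_eq_zero]
  intro p hp
  have h := norm_sq_complexFrame x p
  have hx' : ‖x‖ ^ 2 ≠ 0 := by positivity
  rw [hp, norm_zero, zero_pow two_ne_zero, eq_comm, mul_eq_zero, or_iff_left hx'] at h
  have h1 : ‖p.1‖ ^ 2 = 0 := by nlinarith [sq_nonneg ‖p.1‖, sq_nonneg ‖p.2‖]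
  have h2 : ‖p.2‖ ^ 2 = 0 := by nlinarith [sq_nonneg ‖p.1‖, sq_nonneg ‖p.2‖]
  exact Prod.ext (by simpa using h1) (by simpa using h2)

/-- `complexFrame x` as a continuous linear equivalence, for `x ≠ 0`. -/
def complexFrameEquiv {x : R4} (hx : x ≠ 0) : (ℂ × ℂ) ≃L[ℝ] R4 :=
  (LinearEquiv.ofInjectiveOfFinrankEq (complexFrame x) (complexFrame_injective hx)
    (by simp [Complex.finrank_real_complex])).toContinuousLinearEquiv

theorem complexFrameEquiv_apply {x : R4} (hx : x ≠ 0) (p : ℂ × ℂ) :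
    complexFrameEquiv hx p = complexFrame x p := rfl

theorem complexFrame_mk_zero (x : R4) (z : ℂ) : complexFrame x (z, 0) = complexScale z x := by
  ext i
  fin_cases i <;> simp [complexFrame_apply, complexScale]

/-! ### Integrals of `φ ∗ conj (φ (-·))` along a subspace -/

theorem SchwartzMap.exists_norm_le_one_add_norm {E F : Type*} [NormedAddCommGroup E]
    [NormedSpace ℝ E] [NormedAddCommGroup F] [NormedSpace ℝ F] (f : 𝓢(E, F)) (k : ℕ) :
    ∃ C, 0 ≤ C ∧ ∀ x, ‖f x‖ ≤ C * (1 + ‖x‖) ^ (-(k : ℝ)) := by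
  refine ⟨2 ^ k * (Finset.Iic (k, 0)).sup (fun m => SchwartzMap.seminorm ℝ m.1 m.2) f,
    by positivity, fun x => ?_⟩
  have h := SchwartzMap.one_add_le_sup_seminorm_apply (𝕜 := ℝ) (m := (k, 0)) le_rfl le_rfl f x
  rw [norm_iteratedFDeriv_zero] at h
  rw [Real.rpow_neg (by positivity), Real.rpow_natCast, ← div_eq_mul_inv,
    le_div_iff₀ (by positivity), mul_comm]
  exact h

section Subspace

variable {V W : Type*} [NormedAddCommGroup V] [NormedSpace ℝ V] [FiniteDimensional ℝ V]
  [MeasureSpace V] [BorelSpace V] [(volume : Measure V).IsAddHaarMeasure]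
  [NormedAddCommGroup W] [NormedSpace ℝ W]

theorem SchwartzMap.exists_norm_slice_le (Φ : 𝓢(V × W, ℂ)) :
    ∃ g : V → ℝ, Integrable g ∧ ∀ v w, ‖Φ (v, w)‖ ≤ g v := by
  obtain ⟨C, hC, h⟩ := Φ.exists_norm_le_one_add_norm (Module.finrank ℝ V + 1)
  refine ⟨fun v => C * (1 + ‖v‖) ^ (-((Module.finrank ℝ V + 1 : ℕ) : ℝ)),
    (integrable_one_add_norm (by push_cast; linarith)).const_mul C, fun v w => (h _).trans ?_⟩
  refine mul_le_mul_of_nonneg_left ?_ hC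
  refine Real.rpow_le_rpow_of_nonpos (by positivity) ?_ (neg_nonpos.2 (Nat.cast_nonneg _))
  gcongr
  exact norm_fst_le (v, w)

theorem SchwartzMap.integrable_slice (Φ : 𝓢(V × W, ℂ)) (w : W) :
    Integrable fun v => Φ (v, w) := by
  obtain ⟨g, hg, h⟩ := Φ.exists_norm_slice_le
  exact hg.mono' (by fun_prop) (.of_forall fun v => h v w)

variable [FiniteDimensional ℝ W] [MeasureSpace W] [BorelSpace W]
  [(volume : Measure W).IsAddHaarMeasure]

theorem SchwartzMap.integrable_mul_conj_shift (Φ : 𝓢(V × W, ℂ)) :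
    Integrable (fun q : V × (V × W) => Φ q.2 * conj (Φ (q.2 - (q.1, 0)))) := by
  obtain ⟨g, hg, h⟩ := Φ.exists_norm_slice_le
  have : (volume : Measure (V × W)).IsAddHaarMeasure :=
    Measure.prod.instIsAddHaarMeasure volume volume
  have hnorm (y : V × W) : ∫ x : V, ‖Φ y * conj (Φ (y - (x, 0)))‖ =
      ‖Φ y‖ * ∫ x : V, ‖Φ (x, y.2)‖ := by
    simp only [norm_mul, RCLike.norm_conj, integral_const_mul]
    rw [← integral_sub_left_eq_self (fun x : V => ‖Φ (x, y.2)‖) volume y.1]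
    congr! 6
    simp [Prod.sub_def]
  rw [Measure.volume_eq_prod, integrable_prod_iff' (by fun_prop)]
  refine ⟨.of_forall fun y => ?_, ?_⟩
  · have h1 : Integrable fun x : V => conj (Φ (y.1 - x, y.2)) :=
      Complex.conjCLE.toContinuousLinearMap.integrable_comp
        ((Φ.integrable_slice y.2).comp_sub_left y.1)
    refine (h1.const_mul (Φ y)).congr (.of_forall fun x => ?_)
    simp [Prod.sub_def]
  · simp_rw [hnorm]
    refine (Φ.integrable.norm.mul_const (∫ v, g v)).mono' ?_ (.of_forall fun y => ?_)
    · have : Continuous fun q : W × V => ‖Φ (q.2, q.1)‖ := by fun_prop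
      have h2 := (this.stronglyMeasurable.integral_prod_right' (ν := (volume : Measure V)))
      exact (Φ.continuous.norm.aestronglyMeasurable).mul
        (h2.comp_measurable measurable_snd).aestronglyMeasurable
    · rw [Real.norm_of_nonneg
        (mul_nonneg (norm_nonneg _) (integral_nonneg fun _ => norm_nonneg _))]
      gcongr
      · exact (Φ.integrable_slice y.2).norm
      · exact fun v => h v y.2

theorem SchwartzMap.integral_mul_conj_shift_nonneg (Φ : 𝓢(V × W, ℂ)) :
    0 ≤ ∫ x : V, ∫ y : V × W, Φ y * conj (Φ (y - (x, 0))) := by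
  have hint := Φ.integrable_mul_conj_shift
  rw [Measure.volume_eq_prod] at hint
  have hslice (y : V × W) : ∫ x : V, Φ y * conj (Φ (y - (x, 0))) =
      Φ y * conj (∫ x : V, Φ (x, y.2)) := by
    rw [integral_const_mul, integral_conj]
    congr 2
    rw [← integral_sub_left_eq_self (fun x : V => Φ (x, y.2)) volume y.1]
    simp [Prod.sub_def]
  have hint' := hint.integral_prod_right
  simp only [hslice] at hint'
  rw [integral_integral_swap hint]
  simp_rw [hslice]
  rw [Measure.volume_eq_prod] at hint' ⊢
  rw [integral_prod_symm _ hint']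
  simp_rw [integral_mul_const]
  exact integral_nonneg fun w => mul_star_self_nonneg _

end Subspace

theorem integral_autoConvolution_complexScale_nonneg (φ : 𝓢(R4, ℂ)) {x : R4} (hx : x ≠ 0) :
    0 ≤ ∫ z : ℂ, autoConvolution φ (complexScale z x) := by
  let A := complexFrameEquiv hx
  let Φ : 𝓢(ℂ × ℂ, ℂ) := SchwartzMap.compCLMOfContinuousLinearEquiv ℝ A φ
  have : (volume : Measure (ℂ × ℂ)).IsAddHaarMeasure :=
    Measure.prod.instIsAddHaarMeasure volume volume
  have : (Measure.map A volume).IsAddHaarMeasure := A.isAddHaarMeasure_map volume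
  let c := Measure.addHaarScalarFactor (volume : Measure R4) (Measure.map A volume)
  have hvol : (volume : Measure R4) = c • Measure.map A volume :=
    Measure.isAddLeftInvariant_eq_smul _ _
  have key (z : ℂ) : autoConvolution φ (complexScale z x) =
      (c : ℝ) • ∫ p : ℂ × ℂ, Φ p * conj (Φ (p - (z, 0))) := by
    rw [autoConvolution_apply]
    conv_lhs => rw [hvol]
    have hA : MeasurableEmbedding A := A.toHomeomorph.measurableEmbedding
    rw [integral_smul_nnreal_measure, hA.integral_map, NNReal.smul_def]
    refine congrArg _ (integral_congr_ae (.of_forall fun p => ?_))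
    refine congrArg (fun w => φ (A p) * conj w) ?_
    change φ (A p - _) = φ (A (p - (z, 0)))
    rw [map_sub A, complexFrameEquiv_apply hx (z, 0), complexFrame_mk_zero]
  simp_rw [key]
  rw [integral_smul]
  exact smul_nonneg c.2 Φ.integral_mul_conj_shift_nonneg

/-! ### Properties of the density -/

section Gauge

variable {E : Type*} [NormedAddCommGroup E] [NormedSpace ℝ E] {K : Set E}

theorem gauge_lt_iff_exists_mem_Icc_smul (hK : Absorbent ℝ K) (x : E) (a : ℝ) :
    gauge K x < a ↔ ∃ n : ℕ,
      x ∈ (fun p : ℝ × E => p.1 • p.2) '' (Set.Icc (1 / (n + 1 : ℝ)) (a - 1 / (n + 1)) ×ˢ K) := by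
  constructor
  · intro h
    obtain ⟨b, hb, hba, k, hk, rfl⟩ := exists_lt_of_gauge_lt hK h
    obtain ⟨n, hn⟩ := exists_nat_one_div_lt (lt_min hb (sub_pos.2 hba))
    rw [lt_min_iff] at hn
    exact ⟨n, (b, k), ⟨⟨hn.1.le, by linarith [hn.2]⟩, hk⟩, rfl⟩
  · rintro ⟨n, ⟨b, k⟩, ⟨hb, hk⟩, rfl⟩
    have hn : 0 < 1 / (n + 1 : ℝ) := by positivity
    refine (gauge_le_of_mem (hn.le.trans hb.1) (Set.smul_mem_smul_set hk)).trans_lt ?_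
    have := hb.2
    simp only at this ⊢
    linarith

theorem IsCompact.measurable_gauge [MeasurableSpace E] [BorelSpace E] (hK : IsCompact K)
    (hK' : Absorbent ℝ K) : Measurable (gauge K) := by
  refine measurable_of_Iio fun a => ?_
  have h : gauge K ⁻¹' Set.Iio a = ⋃ n : ℕ,
      (fun p : ℝ × E => p.1 • p.2) '' (Set.Icc (1 / (n + 1 : ℝ)) (a - 1 / (n + 1)) ×ˢ K) := by
    ext x
    simp only [Set.mem_preimage, Set.mem_Iio, gauge_lt_iff_exists_mem_Icc_smul hK', Set.mem_iUnion]
  rw [h]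
  exact .iUnion fun n =>
    ((isCompact_Icc.prod hK).image (by fun_prop)).isClosed.measurableSet

end Gauge

/-- A compact subset of the open unit ball lies in a smaller closed ball. -/
theorem IsCompact.exists_subset_closedBall_of_subset_ball {E : Type*} [NormedAddCommGroup E]
    {K : Set E} (hK : IsCompact K)
    (hball : K ⊆ Metric.ball (0 : E) 1) : ∃ r, 0 < r ∧ r < 1 ∧ K ⊆ Metric.closedBall 0 r := by
  rcases K.eq_empty_or_nonempty with rfl | hne
  · exact ⟨1 / 2, by norm_num, by norm_num, Set.empty_subset _⟩
  obtain ⟨x, hx, hmax⟩ := hK.exists_isMaxOn hne continuous_norm.continuousOn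
  refine ⟨max ‖x‖ (1 / 2), by positivity, max_lt ?_ (by norm_num), fun y hy => ?_⟩
  · simpa using hball hx
  · rw [mem_closedBall_zero_iff]
    exact (hmax hy).trans (le_max_left _ _)

theorem measurable_hyperbolicDensity {K : Set R4} (hK : IsCompact K) (hK' : Absorbent ℝ K) :
    Measurable (hyperbolicDensity K) := by
  have := hK.measurable_gauge hK'
  unfold hyperbolicDensity
  simp only [zpow_neg]
  norm_cast
  fun_prop

theorem hyperbolicDensity_zero (K : Set R4) : hyperbolicDensity K 0 = 0 := by
  simp [hyperbolicDensity]

/-- The density is nonnegative, with a singularity of order at most two at the origin. -/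
theorem exists_hyperbolicDensity_le {K : Set R4} (hK : IsCompact K) (hK' : Absorbent ℝ K)
    (hball : K ⊆ Metric.ball (0 : R4) 1) : ∃ C, 0 ≤ C ∧
      ∀ x, 0 ≤ hyperbolicDensity K x ∧ hyperbolicDensity K x ≤ C * (‖x‖ ^ 2)⁻¹ := by
  obtain ⟨r, hr0, hr1, hKr⟩ := hK.exists_subset_closedBall_of_subset_ball hball
  have hr2 : r ^ 2 < 1 := by nlinarith
  refine ⟨r ^ 2 / (1 - r ^ 2), div_nonneg (by positivity) (by linarith), fun x => ?_⟩
  rcases eq_or_ne x 0 with rfl | hx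
  · simp [hyperbolicDensity_zero]
  have hx' : 0 < ‖x‖ := norm_pos_iff.2 hx
  have hg := le_gauge_of_subset_closedBall (x := x) hK' hr0.le hKr
  have hg0 : 0 < gauge K x := lt_of_lt_of_le (by positivity) hg
  have hle : ‖x‖ ≤ r * gauge K x := by rwa [div_le_iff₀' hr0] at hg
  have hq : (‖x‖ / gauge K x) ^ 2 ≤ r ^ 2 := by
    gcongr
    rwa [div_le_iff₀ hg0]
  have hinv : (gauge K x ^ 2)⁻¹ ≤ r ^ 2 * (‖x‖ ^ 2)⁻¹ := by
    rw [← div_eq_mul_inv, le_div_iff₀ (by positivity), inv_mul_le_iff₀ (by positivity)]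
    nlinarith
  have hz : gauge K x ^ (-2 : ℤ) = (gauge K x ^ 2)⁻¹ := by
    rw [zpow_neg]; norm_cast
  unfold hyperbolicDensity
  rw [hz]
  refine ⟨div_nonneg (by positivity) (by linarith), ?_⟩
  rw [div_mul_eq_mul_div]
  exact div_le_div₀ (by positivity) hinv (by linarith) (by linarith)

theorem IsRThetaInvariant.gauge_complexScale {K : Set R4} (h : IsRThetaInvariant K) (z : ℂ)
    (x : R4) : gauge K (complexScale z x) = ‖z‖ * gauge K x := by
  have hrot : gauge K (rotTheta z.arg (‖z‖ • x)) = gauge K (‖z‖ • x) := by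
    rcases le_or_gt 0 z.arg with h0 | h0
    · exact h _ ⟨h0, by linarith [Complex.arg_le_pi z, Real.pi_pos]⟩ _
    · rw [← h (z.arg + 2 * Real.pi) ⟨by linarith [Complex.neg_pi_lt_arg z, Real.pi_pos],
        by linarith⟩ (‖z‖ • x)]
      simp only [rotTheta, Real.cos_add_two_pi, Real.sin_add_two_pi]
  rw [complexScale_eq_rotTheta, hrot, gauge_smul_of_nonneg (norm_nonneg z), smul_eq_mul]

theorem IsRThetaInvariant.hyperbolicDensity_complexScale {K : Set R4} (h : IsRThetaInvariant K)
    (z : ℂ) (x : R4) :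
    hyperbolicDensity K (complexScale z x) = (‖z‖ ^ 2)⁻¹ * hyperbolicDensity K x := by
  unfold hyperbolicDensity
  rw [h.gauge_complexScale, norm_complexScale]
  rcases eq_or_ne z 0 with rfl | hz
  · simp
  have hz' : ‖z‖ ≠ 0 := norm_ne_zero_iff.2 hz
  rw [mul_div_mul_left _ _ hz', mul_zpow, mul_div_assoc, zpow_neg]
  norm_cast

/-! ### Tempered growth -/

theorem integrable_inv_norm_sq_mul_one_add_norm :
    Integrable fun x : R4 => (‖x‖ ^ 2)⁻¹ * (1 + ‖x‖) ^ (-((4 : ℕ) : ℝ)) := by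
  have h := integrable_fun_norm_addHaar (volume : Measure R4)
    (f := fun t : ℝ => (t ^ 2)⁻¹ * (1 + t) ^ (-((4 : ℕ) : ℝ)))
  refine h.2 ?_
  have h3 : Integrable fun t : ℝ => (1 + ‖t‖) ^ (-(3 : ℝ)) :=
    integrable_one_add_norm (by norm_num)
  refine h3.integrableOn.mono' (by fun_prop) ?_
  filter_upwards [ae_restrict_mem measurableSet_Ioi] with t ht
  have ht : 0 < t := ht
  rw [Real.norm_of_nonneg (by simp; positivity), Real.norm_of_nonneg ht.le]
  simp only [finrank_euclideanSpace_fin, smul_eq_mul]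
  rw [Real.rpow_neg (by positivity), Real.rpow_neg (by positivity)]
  norm_cast
  rw [← mul_assoc, ← div_eq_mul_inv, ← div_eq_mul_inv, ← one_div,
    div_le_div_iff₀ (by positivity) (by positivity)]
  have : t ^ (4 - 1) / t ^ 2 = t := by field_simp
  rw [this]
  nlinarith [pow_pos (by positivity : 0 < 1 + t) 3]

section Density

variable {f : R4 → ℝ} {C : ℝ}

theorem hasTemperateGrowth_withDensity (hf : Measurable f)
    (hfC : ∀ x, 0 ≤ f x ∧ f x ≤ C * (‖x‖ ^ 2)⁻¹) :
    (volume.withDensity fun x => ((f x).toNNReal : ENNReal)).HasTemperateGrowth := by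
  refine ⟨4, ?_⟩
  rw [integrable_withDensity_iff_integrable_smul hf.real_toNNReal]
  refine (integrable_inv_norm_sq_mul_one_add_norm.const_mul C).mono' ?_ (.of_forall fun x => ?_)
  · have := hf.real_toNNReal
    exact (by fun_prop : Measurable _).aestronglyMeasurable
  · rw [NNReal.smul_def, Real.coe_toNNReal _ (hfC x).1, smul_eq_mul,
      Real.norm_of_nonneg (mul_nonneg (hfC x).1 (by positivity)), ← mul_assoc]
    gcongr
    exact (hfC x).2

theorem exists_isRepresentedBy (hf : Measurable f)
    (hfC : ∀ x, 0 ≤ f x ∧ f x ≤ C * (‖x‖ ^ 2)⁻¹) : ∃ T : 𝓢'(R4, ℂ), IsRepresentedBy T f := by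
  have hμ := hasTemperateGrowth_withDensity hf hfC
  refine ⟨(volume.withDensity fun x => ((f x).toNNReal : ENNReal)).toTemperedDistribution,
    fun φ => ?_⟩
  have hsmul (x : R4) : (f x).toNNReal • φ x = (f x : ℂ) * φ x := by
    rw [NNReal.smul_def, Real.coe_toNNReal _ (hfC x).1, Complex.real_smul]
  have h1 : Integrable (fun x => φ x) (volume.withDensity fun x => ((f x).toNNReal : ENNReal)) :=
    φ.integrable
  rw [integrable_withDensity_iff_integrable_smul hf.real_toNNReal] at h1
  simp only [hsmul] at h1
  refine ⟨h1, ?_⟩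
  refine (Measure.toTemperedDistribution_apply _ φ).trans ?_
  rw [integral_withDensity_eq_integral_smul hf.real_toNNReal]
  simp only [hsmul]

end Density

/-! ### Positivity -/

/-- The indicator function of `[1, 2]`. -/
def annulusWeight (t : ℝ) : ℝ := (Set.Icc 1 2).indicator 1 t

theorem annulusWeight_nonneg (t : ℝ) : 0 ≤ annulusWeight t :=
  Set.indicator_nonneg (fun _ _ => zero_le_one) _

theorem measurable_annulusWeight : Measurable annulusWeight :=
  measurable_one.indicator measurableSet_Icc

/-- The density `annulusWeight (s / |z|)` with respect to the scale invariant measure `|z|⁻² dz`. -/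
def scaleKernel (s : ℝ) (z : ℂ) : ℝ := (‖z‖ ^ 2)⁻¹ * annulusWeight (s / ‖z‖)

theorem scaleKernel_nonneg (s : ℝ) (z : ℂ) : 0 ≤ scaleKernel s z :=
  mul_nonneg (by positivity) (annulusWeight_nonneg _)

theorem measurable_scaleKernel : Measurable fun p : ℝ × ℂ => scaleKernel p.1 p.2 := by
  have := measurable_annulusWeight
  unfold scaleKernel
  fun_prop

theorem scaleKernel_smul {s : ℝ} (hs : 0 < s) (z : ℂ) :
    scaleKernel s (s • z) = (s ^ 2)⁻¹ * scaleKernel 1 z := by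
  unfold scaleKernel
  rw [norm_smul, Real.norm_of_nonneg hs.le, mul_pow, mul_inv, mul_assoc, div_mul_eq_div_div,
    div_self hs.ne']

theorem integrable_scaleKernel_one : Integrable (scaleKernel 1) := by
  have h : Integrable ((Metric.closedBall (0 : ℂ) 1).indicator fun _ => (4 : ℝ)) :=
    (integrable_indicator_iff measurableSet_closedBall).2
      (integrableOn_const measure_closedBall_lt_top.ne)
  refine h.mono' (measurable_scaleKernel.comp
    (measurable_const.prodMk measurable_id)).aestronglyMeasurable (.of_forall fun z => ?_)
  rw [Real.norm_of_nonneg (scaleKernel_nonneg _ _)]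
  unfold scaleKernel annulusWeight
  by_cases hz : 1 / ‖z‖ ∈ Set.Icc (1 : ℝ) 2
  · have hz0 : 0 < ‖z‖ := by
      rw [norm_pos_iff]
      rintro rfl
      norm_num at hz
    have ⟨h1, h2⟩ := hz
    have h3 : z ∈ Metric.closedBall (0 : ℂ) 1 := by
      rw [mem_closedBall_zero_iff]
      rwa [le_div_iff₀ hz0, one_mul] at h1
    rw [Set.indicator_of_mem hz, Set.indicator_of_mem h3, Pi.one_apply, mul_one,
      ← inv_pow, ← one_div]
    nlinarith
  · rw [Set.indicator_of_notMem hz, mul_zero]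
    exact Set.indicator_nonneg (fun _ _ => by norm_num) _

theorem integral_scaleKernel_one_pos : 0 < ∫ z, scaleKernel 1 z := by
  rw [integral_pos_iff_support_of_nonneg (scaleKernel_nonneg 1) integrable_scaleKernel_one]
  refine (Metric.measure_ball_pos volume (3 / 4 : ℂ) (by norm_num : (0 : ℝ) < 1 / 8)).trans_le
    (measure_mono fun z hz => ?_)
  rw [mem_ball_iff_norm] at hz
  have h34 : ‖(3 / 4 : ℂ)‖ = 3 / 4 := by norm_num
  have h1 : ‖z‖ ≤ 1 := by linarith [norm_sub_norm_le z (3 / 4)]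
  have h2 : 1 / 2 ≤ ‖z‖ := by
    linarith [norm_sub_norm_le (3 / 4 : ℂ) z, norm_sub_rev z (3 / 4 : ℂ)]
  have hz0 : 0 < ‖z‖ := by linarith
  have hmem : 1 / ‖z‖ ∈ Set.Icc (1 : ℝ) 2 :=
    ⟨by rwa [le_div_iff₀ hz0, one_mul], by rw [div_le_iff₀ hz0]; linarith⟩
  rw [Function.mem_support, scaleKernel, annulusWeight, Set.indicator_of_mem hmem]
  simp [hz0.ne']

theorem integral_scaleKernel {s : ℝ} (hs : 0 < s) :
    ∫ z, scaleKernel s z = ∫ z, scaleKernel 1 z := by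
  have h := Measure.integral_comp_smul (volume : Measure ℂ) (scaleKernel s) s
  simp_rw [scaleKernel_smul hs, integral_const_mul, Complex.finrank_real_complex] at h
  rw [abs_of_pos (by positivity), smul_eq_mul] at h
  exact (mul_left_cancel₀ (by positivity) h).symm

theorem integrable_scaleKernel {s : ℝ} (hs : 0 < s) : Integrable (scaleKernel s) := by
  rw [← integrable_comp_smul_iff (volume : Measure ℂ) (scaleKernel s) hs.ne']
  simp_rw [scaleKernel_smul hs]
  exact integrable_scaleKernel_one.const_mul _

section Density

variable {f : R4 → ℝ} {C : ℝ}

theorem integrable_scaleKernel_mul {g : R4 → ℂ} (hg : Integrable g) :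
    Integrable fun p : ℂ × R4 => (scaleKernel ‖p.2‖ p.1 : ℂ) * g p.2 := by
  have hmeas : Measurable fun p : ℂ × R4 => (scaleKernel ‖p.2‖ p.1 : ℂ) :=
    Complex.measurable_ofReal.comp
      (measurable_scaleKernel.comp (measurable_snd.norm.prodMk measurable_fst))
  have hne : ∀ᵐ y : R4, y ≠ 0 := Measure.ae_ne volume 0
  have hmul : AEStronglyMeasurable (fun p : ℂ × R4 => (scaleKernel ‖p.2‖ p.1 : ℂ) * g p.2)
      (volume.prod volume) := hmeas.aestronglyMeasurable.mul hg.aestronglyMeasurable.comp_snd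
  refine (integrable_prod_iff' hmul).2 ⟨?_, ?_⟩
  · filter_upwards [hne] with y hy
    exact (integrable_scaleKernel (norm_pos_iff.2 hy)).ofReal.mul_const _
  · refine (hg.norm.const_mul (∫ z, scaleKernel 1 z)).congr ?_
    filter_upwards [hne] with y hy
    simp only [norm_mul, Complex.norm_real, Real.norm_of_nonneg (scaleKernel_nonneg _ _)]
    rw [integral_mul_const, integral_scaleKernel (norm_pos_iff.2 hy)]

theorem integral_integral_scaleKernel_mul {g : R4 → ℂ} (hg : Integrable g) :
    ∫ z : ℂ, ∫ y : R4, (scaleKernel ‖y‖ z : ℂ) * g y =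
      (∫ z, scaleKernel 1 z : ℝ) * ∫ y, g y := by
  have hint := integrable_scaleKernel_mul hg
  rw [Measure.volume_eq_prod] at hint
  rw [integral_integral_swap hint, ← integral_const_mul]
  refine integral_congr_ae ?_
  filter_upwards [Measure.ae_ne volume 0] with y hy
  rw [integral_mul_const, integral_complex_ofReal, integral_scaleKernel (norm_pos_iff.2 hy)]

theorem integrable_annulusWeight_mul (hf : Measurable f)
    (hfC : ∀ x, 0 ≤ f x ∧ f x ≤ C * (‖x‖ ^ 2)⁻¹) (hC : 0 ≤ C) (ψ : 𝓢(R4, ℂ)) :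
    Integrable fun p : R4 × ℂ =>
      ((f p.1 * annulusWeight ‖p.1‖ : ℝ) : ℂ) * ψ (complexScale p.2 p.1) := by
  obtain ⟨D, hD, hψ⟩ := ψ.exists_norm_le_one_add_norm 3
  have h1 : Integrable ((Metric.closedBall (0 : R4) 2).indicator fun _ => C) :=
    (integrable_indicator_iff measurableSet_closedBall).2
      (integrableOn_const measure_closedBall_lt_top.ne)
  have h2 : Integrable fun z : ℂ => D * (1 + ‖z‖) ^ (-((3 : ℕ) : ℝ)) :=
    (integrable_one_add_norm (by norm_num [Complex.finrank_real_complex])).const_mul D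
  have hw := measurable_annulusWeight
  refine (h1.mul_prod h2).mono' ?_ (.of_forall fun p => ?_)
  · have h3 : Measurable fun p : R4 × ℂ => ((f p.1 * annulusWeight ‖p.1‖ : ℝ) : ℂ) := by
      fun_prop
    have h4 : Continuous fun p : R4 × ℂ => ψ (complexScale p.2 p.1) :=
      ψ.continuous.comp (continuous_complexScale.comp continuous_swap)
    exact h3.aestronglyMeasurable.mul h4.aestronglyMeasurable
  rw [norm_mul, Complex.norm_real,
    Real.norm_of_nonneg (mul_nonneg (hfC p.1).1 (annulusWeight_nonneg _))]
  by_cases hp : ‖p.1‖ ∈ Set.Icc (1 : ℝ) 2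
  · have hb : p.1 ∈ Metric.closedBall (0 : R4) 2 := by simpa using hp.2
    rw [annulusWeight, Set.indicator_of_mem hp, Set.indicator_of_mem hb, Pi.one_apply, mul_one]
    have h5 : f p.1 ≤ C := (hfC p.1).2.trans
      (mul_le_of_le_one_right hC (inv_le_one_of_one_le₀ (one_le_pow₀ hp.1)))
    refine mul_le_mul h5 ((hψ _).trans ?_) (norm_nonneg _) hC
    refine mul_le_mul_of_nonneg_left ?_ hD
    refine Real.rpow_le_rpow_of_nonpos (by positivity) ?_ (by norm_num)
    rw [norm_complexScale]
    gcongr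
    exact le_mul_of_one_le_right (norm_nonneg _) hp.1
  · rw [annulusWeight, Set.indicator_of_notMem hp, mul_zero, zero_mul]
    exact mul_nonneg (Set.indicator_nonneg (fun _ _ => hC) _) (by positivity)

theorem integral_annulusWeight_mul (hhom : ∀ z x, f (complexScale z x) = (‖z‖ ^ 2)⁻¹ * f x)
    (ψ : R4 → ℂ) {z : ℂ} (hz : z ≠ 0) :
    ∫ x, ((f x * annulusWeight ‖x‖ : ℝ) : ℂ) * ψ (complexScale z x) =
      ∫ y, (scaleKernel ‖y‖ z : ℂ) * ((f y : ℂ) * ψ y) := by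
  have hz' : ‖z‖ ≠ 0 := norm_ne_zero_iff.2 hz
  have hzC : (‖z‖ : ℂ) ≠ 0 := by exact_mod_cast hz'
  have h := integral_comp_complexScale (fun y => (scaleKernel ‖y‖ z : ℂ) * ((f y : ℂ) * ψ y)) z
  have h' (x : R4) : (scaleKernel ‖complexScale z x‖ z : ℂ) *
      ((f (complexScale z x) : ℂ) * ψ (complexScale z x)) =
      ((‖z‖ ^ 4)⁻¹ : ℝ) * (((f x * annulusWeight ‖x‖ : ℝ) : ℂ) * ψ (complexScale z x)) := by
    rw [hhom, norm_complexScale, scaleKernel, mul_div_cancel_left₀ _ hz']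
    push_cast
    field_simp
  simp_rw [h'] at h
  rw [integral_const_mul, Complex.real_smul] at h
  refine mul_left_cancel₀ ?_ h
  simpa using hz

/-- The integral of a homogeneous density against a test function is nonnegative if the integrals
of the test function over all complex lines are. -/
theorem integral_homogeneous_mul_nonneg (hf : Measurable f)
    (hfC : ∀ x, 0 ≤ f x ∧ f x ≤ C * (‖x‖ ^ 2)⁻¹) (hC : 0 ≤ C)
    (hhom : ∀ z x, f (complexScale z x) = (‖z‖ ^ 2)⁻¹ * f x) (ψ : 𝓢(R4, ℂ))
    (hint : Integrable fun x => (f x : ℂ) * ψ x)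
    (hψ : ∀ x ≠ 0, 0 ≤ ∫ z, ψ (complexScale z x)) : 0 ≤ ∫ x, (f x : ℂ) * ψ x := by
  have hF := integrable_annulusWeight_mul hf hfC hC ψ
  rw [Measure.volume_eq_prod] at hF
  have hswap := integral_integral_swap
    (f := fun x z => ((f x * annulusWeight ‖x‖ : ℝ) : ℂ) * ψ (complexScale z x)) hF
  have hR : ∫ z : ℂ, ∫ x, ((f x * annulusWeight ‖x‖ : ℝ) : ℂ) * ψ (complexScale z x) =
      (∫ z, scaleKernel 1 z : ℝ) * ∫ x, (f x : ℂ) * ψ x := by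
    rw [← integral_integral_scaleKernel_mul hint]
    refine integral_congr_ae ?_
    filter_upwards [Measure.ae_ne volume 0] with z hz
    exact integral_annulusWeight_mul hhom ψ hz
  have hL : 0 ≤ ∫ x, ∫ z : ℂ, ((f x * annulusWeight ‖x‖ : ℝ) : ℂ) * ψ (complexScale z x) := by
    refine integral_nonneg_of_ae ?_
    filter_upwards [Measure.ae_ne volume 0] with x hx
    rw [integral_const_mul]
    exact mul_nonneg (Complex.zero_le_real.2 (mul_nonneg (hfC x).1 (annulusWeight_nonneg _)))
      (hψ x hx)
  rw [hswap, hR] at hL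
  have hpos := integral_scaleKernel_one_pos
  have h := mul_nonneg (Complex.zero_le_real.2 (inv_nonneg.2 hpos.le)) hL
  rwa [← mul_assoc, ← Complex.ofReal_mul, inv_mul_cancel₀ hpos.ne', Complex.ofReal_one,
    one_mul] at h

end Density

end

theorem lemma8 (K : Set R4) (hK : IsStarBody K) (hinv : IsRThetaInvariant K)
    (hball : K ⊆ Metric.ball (0 : R4) 1) :
    ∃ T : 𝓢'(R4, ℂ), IsRepresentedBy T (hyperbolicDensity K) ∧
      IsPositiveDefiniteDistribution T := by
  have habs : Absorbent ℝ K := absorbent_nhds_zero (mem_interior_iff_mem_nhds.1 hK.zero_mem_interior)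
  have hmeas := measurable_hyperbolicDensity hK.isCompact habs
  obtain ⟨C, hC, hfC⟩ := exists_hyperbolicDensity_le hK.isCompact habs hball
  obtain ⟨T, hT⟩ := exists_isRepresentedBy hmeas hfC
  refine ⟨T, hT, fun φ => ?_⟩
  rw [(hT _).2]
  exact integral_homogeneous_mul_nonneg hmeas hfC hC hinv.hyperbolicDensity_complexScale _ (hT _).1
    fun x hx => integral_autoConvolution_complexScale_nonneg φ hx
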